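/- Let $\mathbb{K}$ be $\mathbb{R}$ or $\mathbb{C}$, let $\mathcal{A}$ be a (possibly non-commutative) unital $*$-algebra over $\mathbb{K}$, and let $\phi : \mathcal{A} \to \mathbb{K}$ be a $\mathbb{K}$-linear functional with $\phi(1) = 1$ and $\phi(a^*) = \overline{\phi(a)}$ for all $a$ (no positivity or trace property is assumed). Let $X_1, \dots, X_n \in \mathcal{A}$ be self-adjoint. **Joint distribution.** For a word $\vec{u} = (u(1), \dots, u(k))$ put $X_{\vec{u}} = X_{u(1)} \cdots X_{u(k)}$ and $|\vec u| = k$. The joint distribution is the functional $\phi_{\mathbf{X}}$ on the algebra $\mathbb{K}\langle x_1, \dots, x_n\rangle$ of polynomials in non-commuting variables given by $\phi_{\mathbf{X}}[x_{\vec{u}}] = \phi[X_{\vec{u}}]$. This algebra carries the conjugate-linear involution with $(x_{u(1)} \cdots x_{u(k)})^* = x_{u(k)} \cdots x_{u(1)}$. **Free cumulants.** The joint free cumulants of $a_1, \dots, a_k \in \mathcal{A}$ are defined recursively by $$R[a_1, \dots, a_k] = \phi[a_1 \cdots a_k] - \sum_{\pi \in NC(k),\ \pi \neq \hat{1}} \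 \prod_{B \in \pi} R[a_i : i \in B],$$ where $NC(k)$ is the set of non-crossing partitions of $\{1, \dots, k\}$ and $\hat{1}$ is the partition with one class. **Free Appell polynomials.** There is exactly one way to assign to every finite sequence $a_1, \dots, a_k \in \mathcal{A}$ ($k \ge 0$) a polynomial $A_{a_1, \dots, a_k}(x_1, \dots, x_k)$ in non-commuting variables such that $A_\emptyset = 1$; in each monomial the variables appear in increasing order of their indices; $\partial_i A_{a_1, \dots, a_k}(x_1, \dots, x_k) = A_{a_1, \dots, a_{i-1}}(x_1, \dots, x_{i-1}) \, A_{a_{i+1}, \dots, a_k}(x_{i+1}, \dots, x_k)$ for $1 \le i \le k$; and $\phi[A_{a_1, \dots, a_k}(a_1, \dots, a_k)] = 0$ for $k \geq 1$. Here $\partial_i$ is the linear map that sends a monomial to the sum of the monomials obtained from it by omitting one occurrence of $x_i$. The multivariate free Appell polynomials of $X_1, \dots, X_n$ are $$A_{\vec{u}}(x_1, \dots, x_n) = A_{X_{u(1)}, \dots, X_{u(k)}}(x_{u(1)}, \dots, x_{u(k)}), \qquad \vec{u} \in \bigcup_{k \ge 0} \{1, \dots, n\}^k .$$ They are called pseudo-orthogonal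 if $\phi_{\mathbf{X}}[A_{\vec{u}}^* A_{\vec{v}}] = 0$ whenever $|\vec{u}| \neq |\vec{v}|$, and orthogonal if this holds whenever $\vec{u} \neq \vec{v}$. **Claim.** 1. $\{A_{\vec{u}}\}$ is pseudo-orthogonal if and only if $X_1, \dots, X_n$ form a semicircular family, i.e. they are self-adjoint and all their joint free cumulants $R[X_{u(1)}, \dots, X_{u(k)}]$ of order $k > 2$ vanish. 2. $\{A_{\vec{u}}\}$ is orthogonal if and only if $X_1, \dots, X_n$ form a free semicircular family, i.e. a semicircular family whose members are freely independent: $\phi[P_1(X_{i_1}) \cdots P_m(X_{i_m})] = 0$ for all $m \geq 1$, all $i_1 \neq i_2 \neq \dots \neq i_m$ (neighbours distinct) and all one-variable polynomials $P_j$ with $\phi[P_j(X_{i_j})] = 0$. -/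

import Mathlib

noncomputable section

namespace FreeProb

/-! ### Non-commutative polynomials

`FreeAlgebra 𝕜 σ` is the algebra `𝕜⟨x_s : s ∈ σ⟩` of polynomials in non-commuting variables. -/

section Polynomials

variable {𝕜 : Type*} [RCLike 𝕜] {σ : Type*}

/-- The monomial `x_u = x_{u(1)} x_{u(2)} ⋯ x_{u(k)}` of a word `u`. -/
def monomial (𝕜 : Type*) [RCLike 𝕜] {σ : Type*} (u : List σ) : FreeAlgebra 𝕜 σ :=
  (u.map (FreeAlgebra.ι 𝕜)).prod

/-- The coefficient of the monomial `x_u` in `P`. -/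
def coeff (P : FreeAlgebra 𝕜 σ) (u : List σ) : 𝕜 :=
  (FreeAlgebra.basisFreeMonoid 𝕜 σ).repr P (FreeMonoid.ofList u)

theorem basisFreeMonoid_apply (w : FreeMonoid σ) :
    FreeAlgebra.basisFreeMonoid 𝕜 σ w = monomial 𝕜 w.toList := by
  have h : FreeAlgebra.basisFreeMonoid 𝕜 σ w =
      FreeAlgebra.equivMonoidAlgebraFreeMonoid.symm (MonoidAlgebra.single w (1 : 𝕜)) := rfl
  rw [h, AlgEquiv.symm_apply_eq]
  induction w using FreeMonoid.inductionOn' with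
  | one => simp [monomial, MonoidAlgebra.one_def]
  | of_mul x xs ih =>
    have h2 : monomial 𝕜 (FreeMonoid.of x * xs).toList =
        FreeAlgebra.ι 𝕜 x * monomial 𝕜 xs.toList := by
      simp [monomial]
    rw [h2, map_mul, ← ih rfl]
    simp [FreeAlgebra.equivMonoidAlgebraFreeMonoid]

open Classical in
theorem coeff_monomial (u v : List σ) :
    coeff (monomial 𝕜 u) v = if u = v then 1 else 0 := by
  have h := basisFreeMonoid_apply (𝕜 := 𝕜) (FreeMonoid.ofList u)
  rw [FreeMonoid.toList_ofList] at h
  rw [coeff, ← h, Module.Basis.repr_self, Finsupp.single_apply]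
  simp

/-- The involution of `𝕜⟨x⟩`: the conjugate-linear extension of
`x_{u(1)} ⋯ x_{u(k)} ↦ x_{u(k)} ⋯ x_{u(1)}`. -/
def involution (P : FreeAlgebra 𝕜 σ) : FreeAlgebra 𝕜 σ :=
  ((FreeAlgebra.basisFreeMonoid 𝕜 σ).repr P).sum
    fun w c => star c • monomial 𝕜 w.toList.reverse

theorem involution_smul_monomial (c : 𝕜) (u : List σ) :
    involution (c • monomial 𝕜 u) = star c • monomial 𝕜 u.reverse := by
  have h := basisFreeMonoid_apply (𝕜 := 𝕜) (FreeMonoid.ofList u)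
  rw [FreeMonoid.toList_ofList] at h
  rw [involution, ← h, map_smul, Module.Basis.repr_self, Finsupp.smul_single,
    Finsupp.sum_single_index] <;> simp

/-- The partial derivative `∂_i` of non-commutative polynomials: the linear extension of
`∂_i x_u = ∑_{j : u(j) = i} x_{u(1)} ⋯ (x_{u(j)} omitted) ⋯ x_{u(k)}`. -/
def pderiv [DecidableEq σ] (i : σ) : FreeAlgebra 𝕜 σ →ₗ[𝕜] FreeAlgebra 𝕜 σ :=
  (FreeAlgebra.basisFreeMonoid 𝕜 σ).constr 𝕜 fun w =>
    ∑ j : Fin w.toList.length,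
      if w.toList.get j = i then monomial 𝕜 (w.toList.eraseIdx j) else 0

theorem pderiv_monomial [DecidableEq σ] (i : σ) (u : List σ) :
    pderiv i (monomial 𝕜 u) =
      ∑ j : Fin u.length, if u.get j = i then monomial 𝕜 (u.eraseIdx j) else 0 := by
  have h := basisFreeMonoid_apply (𝕜 := 𝕜) (FreeMonoid.ofList u)
  rw [FreeMonoid.toList_ofList] at h
  rw [pderiv, ← h, Module.Basis.constr_basis]
  rfl

/-- Substitution of the entries of a list `l = [b_0, …, b_{k-1}]` for the variables
`x_0, …, x_{k-1}` (the other variables go to `0`; it is only used for polynomials in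
`x_0, …, x_{k-1}`). -/
def subst {B : Type*} [Ring B] [Algebra 𝕜 B] (l : List B) : FreeAlgebra 𝕜 ℕ →ₐ[𝕜] B :=
  FreeAlgebra.lift 𝕜 fun j => l.getD j 0

/-- The shift of variables `x_j ↦ x_{j + m}`. -/
def shift (m : ℕ) : FreeAlgebra 𝕜 ℕ →ₐ[𝕜] FreeAlgebra 𝕜 ℕ :=
  FreeAlgebra.lift 𝕜 fun j => FreeAlgebra.ι 𝕜 (j + m)

/-- Pseudo-orthogonality of a family `P_u`, indexed by words in `1, …, n`, with respect to a
functional `ψ`: `ψ(P_u^* P_v) = 0` whenever `|u| ≠ |v|`. -/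
def IsPseudoOrthogonal (ψ : FreeAlgebra 𝕜 σ →ₗ[𝕜] 𝕜) (P : List σ → FreeAlgebra 𝕜 σ) : Prop :=
  ∀ u v : List σ, u.length ≠ v.length → ψ (involution (P u) * P v) = 0

/-- Orthogonality: `ψ(P_u^* P_v) = 0` whenever `u ≠ v`. -/
def IsOrthogonal (ψ : FreeAlgebra 𝕜 σ →ₗ[𝕜] 𝕜) (P : List σ → FreeAlgebra 𝕜 σ) : Prop :=
  ∀ u v : List σ, u ≠ v → ψ (involution (P u) * P v) = 0

end Polynomials

/-! ### Non-crossing partitions -/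

section Noncrossing

/-- A partition of `{0, …, k-1}` is non-crossing if there are no `a < b < c < d` with `a, c` in
one class and `b, d` in a different class. -/
def IsNoncrossing {k : ℕ} (π : Finpartition (Finset.univ : Finset (Fin k))) : Prop :=
  ∀ B ∈ π.parts, ∀ C ∈ π.parts, ∀ a ∈ B, ∀ b ∈ C, ∀ c ∈ B, ∀ d ∈ C,
    a < b → b < c → c < d → B = C

/-- The subword `(u : B) = (u(v(1)), …, u(v(s)))` of `u` on the positions
`B = {v(1) < ⋯ < v(s)}`. -/
def subword {α : Type*} (u : List α) (B : Finset (Fin u.length)) : List α :=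
  (B.sort (· ≤ ·)).map u.get

theorem length_subword {α : Type*} (u : List α) (B : Finset (Fin u.length)) :
    (subword u B).length = B.card := by
  simp [subword]

open Classical in
/-- The non-crossing partitions of `{0, …, k-1}` other than the one-class partition. -/
def properNC (k : ℕ) : Finset (Finpartition (Finset.univ : Finset (Fin k))) :=
  Finset.univ.filter fun π => IsNoncrossing π ∧ Finset.univ ∉ π.parts

theorem length_subword_lt {α : Type*} (u : List α)
    {π : Finpartition (Finset.univ : Finset (Fin u.length))} (hπ : π ∈ properNC u.length)
    {B : Finset (Fin u.length)} (hB : B ∈ π.parts) : (subword u B).length < u.length := by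
  classical
  rw [length_subword]
  have h1 : Finset.univ ∉ π.parts := by
    simp only [properNC, Finset.mem_filter] at hπ
    exact hπ.2.2
  have h2 : B ≠ Finset.univ := fun h => h1 (h ▸ hB)
  have h3 := Finset.card_lt_univ_of_notMem
    (Classical.not_forall.1 fun h => h2 (Finset.eq_univ_iff_forall.2 h)).choose_spec
  simpa using h3

end Noncrossing

/-! ### Random variables -/

section RandomVariables

variable {𝕜 : Type*} [RCLike 𝕜] {A : Type*} [Ring A] [Algebra 𝕜 A]

/-- The joint free cumulants `R[a_1, …, a_k]` of random variables, defined recursively by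
`R[a_1, …, a_k] = φ(a_1 ⋯ a_k) - ∑_π ∏_{B ∈ π} R[a_i : i ∈ B]`, where `π` runs over the
non-crossing partitions of `k` points other than the one-class partition. -/
def freeCumulant (φ : A →ₗ[𝕜] 𝕜) (l : List A) : 𝕜 :=
  φ l.prod - ∑ π ∈ (properNC l.length).attach, ∏ B ∈ π.1.parts.attach,
    freeCumulant φ (subword l B.1)
termination_by l.length
decreasing_by exact length_subword_lt l π.2 B.2

theorem freeCumulant_eq (φ : A →ₗ[𝕜] 𝕜) (l : List A) :
    freeCumulant φ l = φ l.prod - ∑ π ∈ properNC l.length, ∏ B ∈ π.parts,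
      freeCumulant φ (subword l B) := by
  rw [freeCumulant, ← Finset.sum_attach (properNC l.length)]
  congr 1
  refine Finset.sum_congr rfl fun π _ => ?_
  exact Finset.prod_attach π.1.parts fun B => freeCumulant φ (subword l B)

/-- The joint distribution `φ_X` of `X_1, …, X_n`: the functional on `𝕜⟨x_1, …, x_n⟩` with
`φ_X(x_u) = φ(X_{u(1)} ⋯ X_{u(k)})`. -/
def jointDistribution (φ : A →ₗ[𝕜] 𝕜) {n : ℕ} (X : Fin n → A) :
    FreeAlgebra 𝕜 (Fin n) →ₗ[𝕜] 𝕜 :=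
  φ ∘ₗ (FreeAlgebra.lift 𝕜 X).toLinearMap

/-- `𝒜` assigns to every finite sequence `l = (a_0, …, a_{k-1})` of random variables its
multivariate free Appell polynomial `A_{a_0, …, a_{k-1}}(x_0, …, x_{k-1})`. -/
structure IsFreeAppell (φ : A →ₗ[𝕜] 𝕜) (𝒜 : List A → FreeAlgebra 𝕜 ℕ) : Prop where
  /-- `A_∅ = 1`. -/
  nil : 𝒜 [] = 1
  /-- Only the variables `x_0, …, x_{k-1}` occur. -/
  vars : ∀ (l : List A) (w : List ℕ), coeff (𝒜 l) w ≠ 0 → ∀ j ∈ w, j < l.length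
  /-- In each monomial the variables appear in increasing order of the indices. -/
  ordered : ∀ (l : List A) (w : List ℕ), coeff (𝒜 l) w ≠ 0 → w.Pairwise (· ≤ ·)
  /-- `∂_i A_{a_0, …, a_{k-1}}(x_0, …, x_{k-1})
  = A_{a_0, …, a_{i-1}}(x_0, …, x_{i-1}) A_{a_{i+1}, …, a_{k-1}}(x_{i+1}, …, x_{k-1})`. -/
  pderiv_eq : ∀ (l : List A) (i : ℕ), i < l.length →
    pderiv i (𝒜 l) = 𝒜 (l.take i) * shift (i + 1) (𝒜 (l.drop (i + 1)))
  /-- `φ(A_{a_0, …, a_{k-1}}(a_0, …, a_{k-1})) = 0` for `k ≥ 1`. -/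
  centered : ∀ l : List A, l ≠ [] → φ (subst l (𝒜 l)) = 0

/-- For a fixed tuple `X_1, …, X_n`, the polynomials in `x_1, …, x_n`
`A_u(x) = A_{X_{u(1)}, …, X_{u(k)}}(x_{u(1)}, …, x_{u(k)})`. -/
def appellFamily (𝒜 : List A → FreeAlgebra 𝕜 ℕ) {n : ℕ} (X : Fin n → A) (u : List (Fin n)) :
    FreeAlgebra 𝕜 (Fin n) :=
  subst (u.map (FreeAlgebra.ι 𝕜)) (𝒜 (u.map X))

/-- Free independence of `X_1, …, X_n`: an alternating product of centered polynomials in the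
single variables is centered. -/
def IsFreelyIndependent (φ : A →ₗ[𝕜] 𝕜) {n : ℕ} (X : Fin n → A) : Prop :=
  ∀ l : List (Fin n × Polynomial 𝕜), l ≠ [] →
    l.IsChain (fun p q => p.1 ≠ q.1) →
    (∀ p ∈ l, φ (Polynomial.aeval (X p.1) p.2) = 0) →
    φ (l.map fun p => Polynomial.aeval (X p.1) p.2).prod = 0

/-- `X_1, …, X_n` form a semicircular family: they are self-adjoint and their free cumulant
generating function is quadratic, that is, all joint free cumulants of order `> 2` vanish. -/
structure IsSemicircularFamily [StarRing A] (φ : A →ₗ[𝕜] 𝕜) {n : ℕ} (X : Fin n → A) : Prop where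
  isSelfAdjoint : ∀ i, IsSelfAdjoint (X i)
  freeCumulant_eq_zero : ∀ u : List (Fin n), 2 < u.length → freeCumulant φ (u.map X) = 0

/-- `X_1, …, X_n` form a free semicircular family: a semicircular family of freely independent
random variables. -/
structure IsFreeSemicircularFamily [StarRing A] (φ : A →ₗ[𝕜] 𝕜) {n : ℕ} (X : Fin n → A) :
    Prop extends IsSemicircularFamily φ X where
  isFreelyIndependent : IsFreelyIndependent φ X

end RandomVariables

end FreeProb

end

noncomputable section

namespace FreeProb

open Finset

/-! ### Values of the Appell polynomials: left, right and adjoint recursions -/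

section AppellValues

variable {𝕜 : Type*} [RCLike 𝕜] {A : Type*} [Ring A] [Algebra 𝕜 A]

/-! Write V(l) for the value of the Appell polynomial of a sequence l at l itself. Everything rests
on the expansion a V(l) = V(a l) + ∑ c(a l') V(l'') over all splittings l = l' l'', where c(a l) =
φ(a V(l)). The same recursion, lifted to polynomials, constructs the Appell family. Uniqueness holds
because the derivatives fix an ordered polynomial up to a constant and centering fixes the constant.

The coefficients c are the free cumulants: iterating the expansion on a_1 ⋯ a_k is a sum over
non-crossing partitions (`map_prod_mul_appellValue`). There is a mirror recursion for right
multiplication, so V(l)^* is V of the reversed sequence when the entries are self-adjoint, and the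
pairing of A_u and A_v is φ(V(u reversed) V(v)), with X substituted for the letters.

Since φ(V(a) V(v)) = c(a v) for nonempty v, pseudo-orthogonality kills all cumulants of order > 2,
and orthogonality also the covariances of distinct variables. Conversely, without higher cumulants
both recursions have three terms and φ(V(u a) V(b v)) = c(a, b) φ(V(u) V(v)); iterating gives both
orthogonality statements. For freeness, V(u) V(v) = V(u v) when the letters at the junction have
covariance zero. Centered polynomials in X_i are combinations of V(X_i, …, X_i), so alternating
products of them are combinations of V of nonempty words, on which φ vanishes. -/

/-- The value `A_{a_1, …, a_k}(a_1, …, a_k)` of the free Appell polynomial of a sequence at this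
sequence, defined recursively. -/
def appellValue (φ : A →ₗ[𝕜] 𝕜) : List A → A
  | [] => 1
  | a :: l => a * appellValue φ l - ∑ j ∈ range (l.length + 1),
      φ (a * appellValue φ (l.take j)) • appellValue φ (l.drop j)
termination_by l => l.length
decreasing_by all_goals simp; try omega

/-- The coefficients of the recursion of `appellValue`. They turn out to be the free cumulants. -/
def appellCumulant (φ : A →ₗ[𝕜] 𝕜) : List A → 𝕜
  | [] => 0
  | a :: l => φ (a * appellValue φ l)

variable (φ : A →ₗ[𝕜] 𝕜)

@[simp]
theorem appellValue_nil : appellValue φ [] = 1 := by rw [appellValue]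

theorem appellValue_cons (a : A) (l : List A) :
    appellValue φ (a :: l) = a * appellValue φ l - ∑ j ∈ range (l.length + 1),
      appellCumulant φ (a :: l.take j) • appellValue φ (l.drop j) := by
  rw [appellValue]; rfl

theorem appellCumulant_cons (a : A) (l : List A) :
    appellCumulant φ (a :: l) = φ (a * appellValue φ l) := rfl

theorem mul_appellValue (a : A) (l : List A) :
    a * appellValue φ l = appellValue φ (a :: l) + ∑ j ∈ range (l.length + 1),
      appellCumulant φ (a :: l.take j) • appellValue φ (l.drop j) := by
  rw [appellValue_cons]; abel

variable {φ}

/-- By induction only the full splitting survives in the recursion, and its coefficient φ(a V(l))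
cancels the leading term. -/
theorem map_appellValue (hφ : φ 1 = 1) {l : List A} (hl : l ≠ []) : φ (appellValue φ l) = 0 := by
  induction h : l.length using Nat.strong_induction_on generalizing l with
  | _ k ih =>
    obtain ⟨a, l, rfl⟩ := List.exists_cons_of_ne_nil hl
    rw [appellValue_cons, map_sub, map_sum, sum_range_succ, sum_eq_zero]
    · simp [appellCumulant_cons, hφ]
    · intro j hj
      rw [mem_range] at hj
      rw [map_smul, ih (l.drop j).length _ _ rfl, smul_zero]
      · simp at h ⊢; omega
      · simpa using hj

/-- Splitting off the first letter and splitting off the last letter commute: applying both to b l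
a, in either order, yields the same double sum over the middle segments of l that remain. -/
theorem appellValue_append_singleton (l : List A) (a : A) :
    appellValue φ (l ++ [a]) = appellValue φ l * a - ∑ j ∈ range (l.length + 1),
      appellCumulant φ (l.drop j ++ [a]) • appellValue φ (l.take j) := by
  induction h : l.length using Nat.strong_induction_on generalizing l with
  | _ k ih =>
    cases l with
    | nil => subst h; simp [appellValue_cons]
    | cons b l =>
      simp only [List.length_cons] at h
      subst h
      have h1 : ∀ j ∈ range (l.length + 1),
          appellCumulant φ (b :: (l ++ [a]).take j) • appellValue φ ((l ++ [a]).drop j) =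
          (appellCumulant φ (b :: l.take j) • appellValue φ (l.drop j)) * a -
          ∑ k ∈ range (l.length + 1 - j), appellCumulant φ (b :: l.take j) •
            appellCumulant φ (l.drop (j + k) ++ [a]) • appellValue φ ((l.take (j + k)).drop j) := by
        intro j hj
        have hj' : j ≤ l.length := by simpa [Nat.lt_succ_iff] using hj
        rw [List.take_append_of_le_length hj', List.drop_append_of_le_length hj',
          ih (l.drop j).length (by simp) _ rfl, smul_sub, smul_mul_assoc, smul_sum]
        congr 1
        have : (l.drop j).length + 1 = l.length + 1 - j := by simp; omega
        rw [this]
        refine sum_congr rfl fun k _ => ?_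
        rw [List.drop_drop, List.drop_take]
        simp
      have h2 : ∀ k ∈ range (l.length + 1),
          appellCumulant φ ((b :: l).drop (k + 1) ++ [a]) • appellValue φ ((b :: l).take (k + 1)) =
          b * (appellCumulant φ (l.drop k ++ [a]) • appellValue φ (l.take k)) -
          ∑ j ∈ range (k + 1), appellCumulant φ (b :: l.take j) •
            appellCumulant φ (l.drop k ++ [a]) • appellValue φ ((l.take k).drop j) := by
        intro k hk
        have hk' : k ≤ l.length := by simpa [Nat.lt_succ_iff] using hk
        rw [List.drop_succ_cons, List.take_succ_cons, appellValue_cons, smul_sub, smul_sum,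
          mul_smul_comm]
        congr 1
        rw [List.length_take, min_eq_left hk']
        refine sum_congr rfl fun j hj => ?_
        rw [List.take_take, min_eq_left (by simpa [Nat.lt_succ_iff] using hj), smul_comm]
      -- The remaining segment runs from j to j + k; this reindexes the double sum by its right end.
      have h3 := sum_range_diag_flip (l.length + 1) fun j k => appellCumulant φ (b :: l.take j) •
            appellCumulant φ (l.drop (j + k) ++ [a]) • appellValue φ ((l.take (j + k)).drop j)
      have h4 : ∀ k ∈ range (l.length + 1), ∑ j ∈ range (k + 1), appellCumulant φ (b :: l.take j) •
            appellCumulant φ (l.drop (j + (k - j)) ++ [a]) •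
              appellValue φ ((l.take (j + (k - j))).drop j) =
          ∑ j ∈ range (k + 1), appellCumulant φ (b :: l.take j) •
            appellCumulant φ (l.drop k ++ [a]) • appellValue φ ((l.take k).drop j) := by
        refine fun k _ => sum_congr rfl fun j hj => ?_
        rw [Nat.add_sub_cancel' (by simpa [Nat.lt_succ_iff] using hj)]
      rw [sum_congr rfl h4] at h3
      -- The cumulant of the whole word b l a is the last term of the left recursion and the term j
      -- = 0 of the right one, so both are split off.
      rw [List.cons_append, appellValue_cons, List.length_append, List.length_singleton,
        sum_range_succ, sum_congr rfl h1, sum_sub_distrib, ← h3, sum_range_succ' _ (l.length + 1),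
        sum_congr rfl h2, sum_sub_distrib, ih l.length (by simp) l rfl, appellValue_cons φ b l]
      have h5 : l.length + 1 = (l ++ [a]).length := by simp
      rw [h5, List.take_length, List.drop_length, ← h5]
      simp only [List.drop_zero, List.take_zero, mul_sub, sub_mul, sum_mul, mul_sum, mul_assoc,
        List.cons_append]
      abel

/-- Applying φ to the right recursion leaves only the term of the whole word: c can be read from
either end. -/
theorem appellCumulant_append_singleton (hφ : φ 1 = 1) (l : List A) (a : A) :
    appellCumulant φ (l ++ [a]) = φ (appellValue φ l * a) := by
  have h := congrArg φ (appellValue_append_singleton (φ := φ) l a)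
  rw [map_appellValue hφ (by simp), map_sub, map_sum, sum_range_succ', sum_eq_zero] at h
  · simp only [List.drop_zero, List.take_zero, appellValue_nil, map_smul, hφ, smul_eq_mul, mul_one,
      zero_add] at h
    exact (sub_eq_zero.1 h.symm).symm
  · intro j hj
    rw [mem_range] at hj
    rw [map_smul, map_appellValue hφ, smul_zero]
    intro h0
    have := congrArg List.length h0
    simp at this
    subst this
    simp at hj

/-- The adjoint exchanges the left and right recursions, and the two descriptions of c make the
coefficients conjugate. -/
theorem star_appellValue [StarRing A] [StarModule 𝕜 A] (hφ : φ 1 = 1)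
    (hφ_star : ∀ a : A, φ (star a) = star (φ a)) (l : List A) (hl : ∀ a ∈ l, IsSelfAdjoint a) :
    star (appellValue φ l.reverse) = appellValue φ l := by
  induction h : l.length using Nat.strong_induction_on generalizing l with
  | _ k ih =>
    cases l with
    | nil => simp
    | cons a l =>
      simp only [List.length_cons] at h
      subst h
      have ha : star a = a := hl a (by simp)
      have hl' : ∀ a ∈ l, IsSelfAdjoint a := fun b hb => hl b (by simp [hb])
      have h1 : ∀ j, appellCumulant φ ((l.take j).reverse ++ [a]) =
          star (appellCumulant φ (a :: l.take j)) := by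
        intro j
        rw [appellCumulant_append_singleton hφ, appellCumulant_cons, ← hφ_star, star_mul, ha,
          ← ih (l.take j).length (by simp) (l.take j)
            (fun b hb => hl' b (List.mem_of_mem_take hb)) rfl, star_star]
      rw [List.reverse_cons, appellValue_append_singleton, star_sub, star_mul, ha,
        ih l.length (by simp) l hl' rfl, appellValue_cons, star_sum, List.length_reverse,
        ← sum_range_reflect]
      congr 1
      refine sum_congr rfl fun j hj => ?_
      have hj' : j ≤ l.length := by simpa [Nat.lt_succ_iff] using hj
      have e1 : l.reverse.drop (l.length + 1 - 1 - j) = (l.take j).reverse := by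
        rw [List.reverse_take]; congr 1
      have e2 : l.reverse.take (l.length + 1 - 1 - j) = (l.drop j).reverse := by
        rw [List.reverse_drop]; congr 1
      rw [e1, e2, h1, star_smul, star_star,
        ih (l.drop j).length (by simp) (l.drop j)
          (fun b hb => hl' b (List.mem_of_mem_drop hb)) rfl]

end AppellValues

/-! ### Recursion for restricted sums over non-crossing partitions -/

section Noncrossing

variable {α : Type*} [LinearOrder α]

/-- The classes `P` form a non-crossing partition of `S` no class of which is contained in `T`. -/
structure IsNCPart (S T : Finset α) (P : Finset (Finset α)) : Prop where
  subset : ∀ B ∈ P, B ⊆ S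
  cover : ∀ x ∈ S, ∃ B ∈ P, x ∈ B
  nonempty : ∀ B ∈ P, B.Nonempty
  disjoint : ∀ B ∈ P, ∀ C ∈ P, ∀ x, x ∈ B → x ∈ C → B = C
  noncrossing : ∀ B ∈ P, ∀ C ∈ P, ∀ a ∈ B, ∀ b ∈ C, ∀ c ∈ B, ∀ d ∈ C,
    a < b → b < c → c < d → B = C
  not_subset : ∀ B ∈ P, ¬ B ⊆ T

/-- Removing a class. -/
theorem IsNCPart.erase {S T : Finset α} {P : Finset (Finset α)} (h : IsNCPart S T P)
    {I : Finset α} (hI : I ∈ P) : IsNCPart (S \ I) (T \ I) (P.erase I) where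
  subset B hB x hx := by
    have hB' := mem_erase.1 hB
    exact mem_sdiff.2 ⟨h.subset B hB'.2 hx, fun hxI => hB'.1 (h.disjoint B hB'.2 I hI x hx hxI)⟩
  cover x hx := by
    obtain ⟨hx, hxI⟩ := mem_sdiff.1 hx
    obtain ⟨B, hB, hxB⟩ := h.cover x hx
    exact ⟨B, mem_erase.2 ⟨fun e => hxI (e ▸ hxB), hB⟩, hxB⟩
  nonempty B hB := h.nonempty B (mem_of_mem_erase hB)
  disjoint B hB C hC := h.disjoint B (mem_of_mem_erase hB) C (mem_of_mem_erase hC)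
  noncrossing B hB C hC := h.noncrossing B (mem_of_mem_erase hB) C (mem_of_mem_erase hC)
  not_subset B hB hBT := h.not_subset B (mem_of_mem_erase hB) (hBT.trans sdiff_subset)

/-- Inserting an interval as a class. -/
theorem IsNCPart.insert {S T I : Finset α} {P : Finset (Finset α)}
    (h : IsNCPart (S \ I) (T \ I) P) (hIS : I ⊆ S) (hne : I.Nonempty) (hIT : ¬ I ⊆ T)
    (hint : ∀ a ∈ I, ∀ b ∈ S, ∀ c ∈ I, a < b → b < c → b ∈ I) :
    IsNCPart S T (insert I P) where
  subset B hB := by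
    rcases mem_insert.1 hB with rfl | hB
    · exact hIS
    · exact (h.subset B hB).trans sdiff_subset
  cover x hx := by
    by_cases hxI : x ∈ I
    · exact ⟨I, mem_insert_self _ _, hxI⟩
    · obtain ⟨B, hB, hxB⟩ := h.cover x (mem_sdiff.2 ⟨hx, hxI⟩)
      exact ⟨B, mem_insert_of_mem hB, hxB⟩
  nonempty B hB := by
    rcases mem_insert.1 hB with rfl | hB
    exacts [hne, h.nonempty B hB]
  disjoint B hB C hC x hxB hxC := by
    rcases mem_insert.1 hB with rfl | hB' <;> rcases mem_insert.1 hC with rfl | hC'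
    · rfl
    · exact absurd hxB (mem_sdiff.1 (h.subset C hC' hxC)).2
    · exact absurd hxC (mem_sdiff.1 (h.subset B hB' hxB)).2
    · exact h.disjoint B hB' C hC' x hxB hxC
  noncrossing B hB C hC a ha b hb c hc d hd hab hbc hcd := by
    rcases mem_insert.1 hB with rfl | hB' <;> rcases mem_insert.1 hC with rfl | hC'
    · rfl
    · obtain ⟨h1, h2⟩ := mem_sdiff.1 (h.subset C hC' hb)
      exact absurd (hint a ha b h1 c hc hab hbc) h2
    · obtain ⟨h1, h2⟩ := mem_sdiff.1 (h.subset B hB' hc)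
      exact absurd (hint b hb c h1 d hd hbc hcd) h2
    · exact h.noncrossing B hB' C hC' a ha b hb c hc d hd hab hbc hcd
  not_subset B hB hBT := by
    rcases mem_insert.1 hB with rfl | hB
    · exact hIT hBT
    · exact h.not_subset B hB fun x hx =>
        mem_sdiff.2 ⟨hBT hx, (mem_sdiff.1 (h.subset B hB hx)).2⟩

/-- A part of a list that is closed under taking earlier entries is an initial segment. -/
theorem exists_take_of_isLowerSet (q : List α) (hq : q.Pairwise (· < ·)) (D : α → Prop)
    (hD : ∀ x ∈ q, ∀ y ∈ q, x < y → D y → D x) :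
    ∃ j ≤ q.length, ∀ y ∈ q, D y ↔ y ∈ q.take j := by
  induction q with
  | nil => exact ⟨0, by simp⟩
  | cons x q ih =>
    obtain ⟨hxq, hq⟩ := List.pairwise_cons.1 hq
    by_cases hx : D x
    · obtain ⟨j, hj, h⟩ := ih hq fun a ha b hb => hD a (by simp [ha]) b (by simp [hb])
      refine ⟨j + 1, by simpa using hj, fun y hy => ?_⟩
      rw [List.take_succ_cons, List.mem_cons]
      rcases List.mem_cons.1 hy with rfl | hy
      · simp [hx]
      · rw [h y hy]
        simp [(hxq y hy).ne']
    · refine ⟨0, by simp, fun y hy => ?_⟩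
      rcases List.mem_cons.1 hy with rfl | hy
      · simpa using hx
      · simpa using fun hDy => hx (hD x (by simp) y (by simp [hy]) (hxq y hy) hDy)

/-- If the smallest element `i` of `i :: q` is in a class contained in `i :: q`, where no class is
contained in `q`, then this class is an initial segment of `i :: q`. -/
theorem IsNCPart.exists_eq_take {p q : List α} {i : α} (hs : (p ++ i :: q).Pairwise (· < ·))
    {P : Finset (Finset α)} (h : IsNCPart (p ++ i :: q).toFinset q.toFinset P) {B : Finset α}
    (hB : B ∈ P) (hBq : B ⊆ (i :: q).toFinset) :
    ∃ j ∈ range (q.length + 1), B = (i :: q.take j).toFinset := by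
  obtain ⟨hp, hiq, hpq⟩ := List.pairwise_append.1 hs
  obtain ⟨hi, hq⟩ := List.pairwise_cons.1 hiq
  have hiB : i ∈ B := by
    by_contra hiB
    refine h.not_subset B hB fun x hx => ?_
    have := hBq hx
    simp only [List.toFinset_cons, mem_insert] at this
    exact this.resolve_left fun e => hiB (e ▸ hx)
  -- If x < y with y in B, the class C of x is B: otherwise C misses i, so, not lying inside q, it
  -- has an element a in p, and a < i < x < y is a crossing.
  obtain ⟨j, hj, hjB⟩ := exists_take_of_isLowerSet q hq (· ∈ B) fun x hx y hy hxy hyB => by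
    obtain ⟨C, hC, hxC⟩ := h.cover x (by simp [hx])
    by_cases hiC : i ∈ C
    · rwa [h.disjoint B hB C hC i hiB hiC]
    obtain ⟨a, haC, haq⟩ := Finset.not_subset.1 (h.not_subset C hC)
    have hap : a ∈ p := by
      have := h.subset C hC haC
      simp only [List.mem_toFinset, List.mem_append, List.mem_cons] at this haq
      rcases this with h1 | h1 | h1
      exacts [h1, absurd (h1 ▸ haC) hiC, absurd h1 haq]
    rwa [← h.noncrossing C hC B hB a haC i hiB x hxC y hyB (hpq a hap i (by simp)) (hi x hx) hxy]
  refine ⟨j, mem_range.2 (by omega), Finset.ext fun y => ?_⟩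
  simp only [List.toFinset_cons, mem_insert, List.mem_toFinset]
  constructor
  · intro hy
    have := hBq hy
    simp only [List.toFinset_cons, mem_insert, List.mem_toFinset] at this
    exact this.imp_right fun h' => (hjB y h').1 hy
  · rintro (rfl | hy)
    exacts [hiB, (hjB y (List.mem_of_mem_take hy)).2 hy]

open Classical in
/-- The sum over the non-crossing partitions of `S` without classes inside `T` of the products of
the weights of the classes. -/
def ncSum {R : Type*} [CommRing R] [Fintype α] (f : Finset α → R)
    (S T : Finset α) : R :=
  ∑ P : Finset (Finset α) with IsNCPart S T P, ∏ B ∈ P, f B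

theorem toFinset_append_cons_sdiff {p q : List α} {i : α} (hs : (p ++ i :: q).Pairwise (· < ·))
    (j : ℕ) : (p ++ i :: q).toFinset \ (i :: q.take j).toFinset = (p ++ q.drop j).toFinset ∧
      q.toFinset \ (i :: q.take j).toFinset = (q.drop j).toFinset := by
  have hn : (p ++ (i :: (q.take j ++ q.drop j))).Nodup := by
    rw [List.take_append_drop]; exact hs.imp fun h => h.ne
  have e : ∀ x, x ∈ q ↔ x ∈ q.take j ∨ x ∈ q.drop j := fun x => by
    rw [← List.mem_append, List.take_append_drop]
  rw [List.nodup_append, List.nodup_cons, List.nodup_append] at hn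
  constructor <;> ext x <;>
    simp only [mem_sdiff, List.mem_toFinset, List.mem_append, List.mem_cons, e] <;> grind

/-- The combinatorial counterpart of `mul_appellValue`. Either no class lies inside i q, or one
does; the latter contains i and is an initial segment of i q, and removing it leaves a partition of
the same kind. -/
theorem ncSum_append_cons {R : Type*} [CommRing R] [Fintype α] (f : Finset α → R) {p q : List α}
    {i : α} (hs : (p ++ i :: q).Pairwise (· < ·)) :
    ncSum f (p ++ i :: q).toFinset q.toFinset =
      ncSum f (p ++ i :: q).toFinset (i :: q).toFinset +
      ∑ j ∈ range (q.length + 1), f (i :: q.take j).toFinset *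
        ncSum f (p ++ q.drop j).toFinset (q.drop j).toFinset := by
  classical
  obtain ⟨hp, hiq, hpq⟩ := List.pairwise_append.1 hs
  obtain ⟨hi, hq⟩ := List.pairwise_cons.1 hiq
  have hiq' : i ∉ q := fun h => (hi i h).false
  set S := (p ++ i :: q).toFinset with hS
  set I : ℕ → Finset α := fun j => (i :: q.take j).toFinset with hI
  have hIS : ∀ j, I j ⊆ S := fun j x hx => by
    simp only [hI, hS, List.mem_toFinset, List.mem_append, List.mem_cons] at hx ⊢
    exact Or.inr (hx.imp_right List.mem_of_mem_take)
  have hiI : ∀ j, i ∈ I j := fun j => by simp [hI]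
  have hIq : ∀ j, ¬ I j ⊆ q.toFinset := fun j h => hiq' (by simpa using h (hiI j))
  have hIiq : ∀ j, I j ⊆ (i :: q).toFinset := fun j x hx => by
    simp only [hI, List.mem_toFinset, List.mem_cons] at hx ⊢
    exact hx.imp_right List.mem_of_mem_take
  have hint : ∀ j, ∀ a ∈ I j, ∀ b ∈ S, ∀ c ∈ I j, a < b → b < c → b ∈ I j := by
    intro j a ha b hb c hc hab hbc
    simp only [hI, hS, List.mem_toFinset, List.mem_append, List.mem_cons] at ha hb hc ⊢
    have hia : i ≤ a := by
      rcases ha with rfl | ha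
      exacts [le_rfl, (hi a (List.mem_of_mem_take ha)).le]
    rcases hb with hb | hb | hb
    · exact absurd (hpq b hb i (by simp)) (hia.trans hab.le).not_gt
    · exact Or.inl hb
    · rw [← List.take_append_drop j q, List.mem_append] at hb
      refine Or.inr (hb.resolve_right fun hb => ?_)
      rw [← List.take_append_drop j q] at hq
      rcases hc with rfl | hc
      · exact (hia.trans_lt (hab.trans hbc)).false
      · exact absurd ((List.pairwise_append.1 hq).2.2 c hc b hb) hbc.not_gt
  -- Two such initial segments share i, so they are the same class, and cardinality recovers j.
  have hdis : ∀ {P : Finset (Finset α)}, IsNCPart S q.toFinset P → ∀ j ≤ q.length, ∀ k ≤ q.length,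
      I j ∈ P → I k ∈ P → j = k := by
    intro P hP j hj k hk h1 h2
    have e := congrArg Finset.card (hP.disjoint _ h1 _ h2 i (hiI j) (hiI k))
    have hc : ∀ j ≤ q.length, (I j).card = j + 1 := by
      intro j hj
      rw [hI, List.toFinset_card_of_nodup]
      · simpa using hj
      · exact List.nodup_cons.2 ⟨fun h => hiq' (List.mem_of_mem_take h),
          (hq.imp fun h => h.ne).sublist (List.take_sublist j q)⟩
    rw [hc j hj, hc k hk] at e
    omega
  have hsplit : (univ.filter (IsNCPart S q.toFinset)) =
      univ.filter (IsNCPart S (i :: q).toFinset) ∪ (range (q.length + 1)).biUnion fun j =>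
        univ.filter fun P => IsNCPart S q.toFinset P ∧ I j ∈ P := by
    ext P
    simp only [mem_filter_univ, mem_union, mem_biUnion]
    constructor
    · intro h
      by_cases h' : ∀ B ∈ P, ¬ B ⊆ (i :: q).toFinset
      · exact Or.inl { h with not_subset := h' }
      · push Not at h'
        obtain ⟨B, hB, hBq⟩ := h'
        obtain ⟨j, hj, rfl⟩ := h.exists_eq_take hs hB hBq
        exact Or.inr ⟨j, hj, h, hB⟩
    · rintro (h | ⟨j, hj, h, -⟩)
      · exact { h with not_subset := fun B hB hBq => h.not_subset B hB (hBq.trans (by simp)) }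
      · exact h
  unfold ncSum
  rw [hsplit, sum_union, sum_biUnion]
  · congr 1
    refine sum_congr rfl fun j hj => ?_
    obtain ⟨e1, e2⟩ := toFinset_append_cons_sdiff hs j
    rw [mul_sum, ← e1, ← e2]
    symm
    have hnot : ∀ P, IsNCPart (S \ I j) (q.toFinset \ I j) P → I j ∉ P := fun P hP hIP =>
      (mem_sdiff.1 (hP.subset _ hIP (hiI j))).2 (hiI j)
    refine sum_bij' (fun P _ => insert (I j) P) (fun P _ => P.erase (I j)) ?_ ?_ ?_ ?_ ?_
    · intro P hP
      rw [mem_filter_univ] at hP ⊢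
      exact ⟨hP.insert (hIS j) ⟨i, hiI j⟩ (hIq j) (hint j), mem_insert_self _ _⟩
    · intro P hP
      rw [mem_filter_univ] at hP ⊢
      exact hP.1.erase hP.2
    · intro P hP
      rw [mem_filter_univ] at hP
      exact erase_insert (hnot P hP)
    · intro P hP
      rw [mem_filter_univ] at hP
      exact insert_erase hP.2
    · intro P hP
      rw [mem_filter_univ] at hP
      exact (prod_insert (hnot P hP)).symm
  · intro j hj k hk hjk
    refine disjoint_left.2 fun P h1 h2 => hjk ?_
    simp only [mem_filter_univ] at h1 h2
    exact hdis h1.1 j (by simpa [Nat.lt_succ_iff] using hj) k (by simpa [Nat.lt_succ_iff] using hk)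
      h1.2 h2.2
  · refine disjoint_left.2 fun P h1 h2 => ?_
    simp only [mem_filter_univ, mem_biUnion] at h1 h2
    obtain ⟨j, -, -, hj⟩ := h2
    exact h1.not_subset _ hj (hIiq j)

end Noncrossing

/-! ### The recursion coefficients are the free cumulants -/

section Cumulants

variable {𝕜 : Type*} [RCLike 𝕜] {A : Type*} [Ring A] [Algebra 𝕜 A] {φ : A →ₗ[𝕜] 𝕜}
  {α : Type*} [LinearOrder α] [Fintype α]

/-- Moving the last letter of p into the Appell factor changes both sides by the same recursion. An
Appell factor thus forbids the classes made only of its own letters; for empty q this is the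
moment-cumulant formula. -/
theorem map_prod_mul_appellValue (hφ : φ 1 = 1) (g : α → A) (p q : List α)
    (hs : (p ++ q).Pairwise (· < ·)) :
    φ ((p.map g).prod * appellValue φ (q.map g)) =
      ncSum (fun B => appellCumulant φ ((B.sort (· ≤ ·)).map g)) (p ++ q).toFinset q.toFinset := by
  classical
  induction p using List.reverseRecOn generalizing q with
  | nil =>
    rcases q with _ | ⟨i, q⟩
    · have : (univ.filter (IsNCPart (∅ : Finset α) ∅)) = {∅} := by
        ext P
        simp only [mem_filter_univ, mem_singleton]
        constructor
        · exact fun h => eq_empty_of_forall_notMem fun B hB => h.not_subset B hB (h.subset B hB)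
        · rintro rfl
          constructor <;> simp
      simp [ncSum, this, hφ]
    -- With p empty and q nonempty no partition is admissible, matching the centering of V.
    · rw [List.map_nil, List.prod_nil, one_mul, map_appellValue hφ (by simp), ncSum,
        filter_eq_empty_iff.2, sum_empty]
      intro P _ hP
      obtain ⟨B, hB, -⟩ := hP.cover i (by simp)
      exact hP.not_subset B hB (hP.subset B hB)
  | append_singleton p i ih =>
    rw [List.append_assoc, List.singleton_append] at hs ⊢
    obtain ⟨hp, hiq, hpq⟩ := List.pairwise_append.1 hs
    rw [ncSum_append_cons _ hs, List.map_append, List.prod_append, List.map_singleton,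
      List.prod_singleton, mul_assoc, mul_appellValue, mul_add, map_add, ← List.map_cons,
      ih _ hs, mul_sum, map_sum, List.length_map]
    congr 1
    refine sum_congr rfl fun j _ => ?_
    have h1 : (i :: q.take j).Pairwise (· < ·) :=
      hiq.sublist ((List.take_sublist j q).cons_cons i)
    have h2 : (p ++ q.drop j).Pairwise (· < ·) :=
      hs.sublist ((List.Sublist.refl p).append (((List.drop_sublist j q)).cons i))
    have h3 : (i :: q.take j).toFinset.sort (· ≤ ·) = i :: q.take j :=
      (List.toFinset_sort (· ≤ ·) (h1.imp fun h => h.ne)).2 (h1.imp fun h => h.le)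
    rw [← ih _ h2, h3, mul_smul_comm, map_smul, smul_eq_mul, List.map_cons, List.map_take,
      List.map_drop]

/-- Both satisfy the moment-cumulant formula, which determines the top cumulant from those of
shorter words once the one-class partition is split off. -/
theorem freeCumulant_eq_appellCumulant (hφ : φ 1 = 1) (l : List A) (hl : l ≠ []) :
    freeCumulant φ l = appellCumulant φ l := by
  classical
  induction h : l.length using Nat.strong_induction_on generalizing l with
  | _ k ih =>
    subst h
    have h1 := map_prod_mul_appellValue hφ l.get (List.finRange l.length) []
      (by simpa using List.pairwise_lt_finRange l.length)
    have h0 : (List.finRange l.length).toFinset = univ := by ext; simp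
    simp only [List.append_nil, List.map_nil, appellValue_nil, mul_one, h0, List.toFinset_nil] at h1
    rw [show (List.finRange l.length).map l.get = l by simp] at h1
    have hne : (univ : Finset (Fin l.length)).Nonempty :=
      ⟨⟨0, List.length_pos_iff.2 hl⟩, mem_univ _⟩
    rw [freeCumulant_eq, h1, ncSum, sub_eq_iff_eq_add]
    have h2 : (univ.filter (IsNCPart (univ : Finset (Fin l.length)) ∅)) =
        insert {univ} ((properNC l.length).image Finpartition.parts) := by
      ext P
      simp only [mem_filter_univ, mem_insert, mem_image, properNC]
      constructor
      · intro hP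
        by_cases hu : univ ∈ P
        · left
          refine eq_singleton_iff_unique_mem.2 ⟨hu, fun B hB => ?_⟩
          obtain ⟨x, hx⟩ := hP.nonempty B hB
          exact hP.disjoint B hB _ hu x hx (mem_univ x)
        · refine Or.inr ⟨Finpartition.ofExistsUnique P (fun p _ => subset_univ p)
            (fun a ha => ?_) fun he => not_nonempty_empty (hP.nonempty _ he), ⟨?_, hu⟩, rfl⟩
          · obtain ⟨B, hB, haB⟩ := hP.cover a ha
            exact ⟨B, ⟨hB, haB⟩, fun C hC => hP.disjoint C hC.1 B hB a hC.2 haB⟩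
          · exact hP.noncrossing
      · rintro (rfl | ⟨π, ⟨hπ, -⟩, rfl⟩)
        · constructor <;> simp [hne, hne.ne_empty]
        · exact
            { subset := fun B _ => subset_univ B
              cover := fun x hx => π.exists_mem hx
              nonempty := fun B hB => π.nonempty_of_mem_parts hB
              disjoint := fun B hB C hC x hxB hxC => π.eq_of_mem_parts hB hC hxB hxC
              noncrossing := hπ
              not_subset := fun B hB h => (π.nonempty_of_mem_parts hB).ne_empty
                (subset_empty.1 h) }
    rw [h2, sum_insert, sum_image]
    · rw [prod_singleton, Fin.sort_univ, show (List.finRange l.length).map l.get = l by simp]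
      congr 1
      refine sum_congr rfl fun π hπ => prod_congr rfl fun B hB => ?_
      refine (ih _ (length_subword_lt l hπ hB) (subword l B) ?_ rfl).symm
      rw [← List.length_pos_iff, length_subword]
      exact card_pos.2 (π.nonempty_of_mem_parts hB)
    · intro π _ π' _ e
      exact Finpartition.ext e
    · simp only [mem_image, not_exists, not_and, properNC, mem_filter_univ]
      exact fun π hπ e => hπ.2 (e ▸ mem_singleton_self _)

end Cumulants

/-! ### Supports and the Leibniz rule in the free algebra -/

section Polynomials

variable {𝕜 : Type*} [RCLike 𝕜] {σ : Type*}

@[simp]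
theorem monomial_nil : monomial 𝕜 ([] : List σ) = 1 := by simp [monomial]

theorem monomial_append (u v : List σ) :
    monomial 𝕜 (u ++ v) = monomial 𝕜 u * monomial 𝕜 v := by simp [monomial]

theorem monomial_cons (i : σ) (u : List σ) :
    monomial 𝕜 (i :: u) = FreeAlgebra.ι 𝕜 i * monomial 𝕜 u := by simp [monomial]

/-- The polynomials all of whose monomials are indexed by words in `Q`. -/
def supportedOn (𝕜 : Type*) [RCLike 𝕜] {σ : Type*} (Q : Set (List σ)) :
    Submodule 𝕜 (FreeAlgebra 𝕜 σ) :=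
  Submodule.span 𝕜 (monomial 𝕜 '' Q)

/-- `coeff` as a linear functional. -/
def coeffₗ (𝕜 : Type*) [RCLike 𝕜] {σ : Type*} (u : List σ) : FreeAlgebra 𝕜 σ →ₗ[𝕜] 𝕜 :=
  (FreeAlgebra.basisFreeMonoid 𝕜 σ).coord (FreeMonoid.ofList u)

theorem coeffₗ_apply (u : List σ) (P : FreeAlgebra 𝕜 σ) : coeffₗ 𝕜 u P = coeff P u := rfl

theorem sum_coeff_monomial (P : FreeAlgebra 𝕜 σ) :
    ((FreeAlgebra.basisFreeMonoid 𝕜 σ).repr P).sum (fun w c => c • monomial 𝕜 w.toList) = P := by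
  conv_rhs => rw [← (FreeAlgebra.basisFreeMonoid 𝕜 σ).linearCombination_repr P]
  rw [Finsupp.linearCombination_apply]
  simp only [basisFreeMonoid_apply]

theorem mem_supportedOn {Q : Set (List σ)} {P : FreeAlgebra 𝕜 σ} :
    P ∈ supportedOn 𝕜 Q ↔ ∀ u, coeff P u ≠ 0 → u ∈ Q := by
  classical
  constructor
  · intro hP
    induction hP using Submodule.span_induction with
    | mem x hx =>
      obtain ⟨v, hv, rfl⟩ := hx
      intro u hu
      rw [coeff_monomial] at hu
      have : v = u := by_contra fun h => hu (if_neg h)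
      exact this ▸ hv
    | zero => simp [← coeffₗ_apply]
    | add x y _ _ hx hy =>
      intro u hu
      by_cases h : coeff x u = 0
      · refine hy u fun h' => hu ?_
        simp only [← coeffₗ_apply] at h h' ⊢
        rw [map_add, h, h', add_zero]
      · exact hx u h
    | smul c x _ hx =>
      intro u hu
      refine hx u fun h => hu ?_
      simp only [← coeffₗ_apply] at h ⊢
      rw [map_smul, h, smul_zero]
  · intro h
    rw [← sum_coeff_monomial P]
    refine Submodule.sum_mem _ fun w hw => Submodule.smul_mem _ _ (Submodule.subset_span
      ⟨_, h w.toList (Finsupp.mem_support_iff.1 hw), rfl⟩)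

theorem monomial_mem_supportedOn {Q : Set (List σ)} {u : List σ} (hu : u ∈ Q) :
    monomial 𝕜 u ∈ supportedOn 𝕜 Q := Submodule.subset_span ⟨u, hu, rfl⟩

theorem linearMap_ext_monomial {M : Type*} [AddCommGroup M] [Module 𝕜 M] {Q : Set (List σ)}
    {f g : FreeAlgebra 𝕜 σ →ₗ[𝕜] M} (h : ∀ u ∈ Q, f (monomial 𝕜 u) = g (monomial 𝕜 u))
    {P : FreeAlgebra 𝕜 σ} (hP : P ∈ supportedOn 𝕜 Q) : f P = g P := by
  refine LinearMap.eqOn_span (s := monomial 𝕜 '' Q) ?_ hP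
  rintro _ ⟨u, hu, rfl⟩
  exact h u hu

theorem mem_supportedOn_univ (P : FreeAlgebra 𝕜 σ) : P ∈ supportedOn 𝕜 (Set.univ) :=
  mem_supportedOn.2 fun _ _ => trivial

theorem supportedOn_mono {Q Q' : Set (List σ)} (h : Q ⊆ Q') :
    supportedOn 𝕜 Q ≤ supportedOn 𝕜 Q' := Submodule.span_mono (Set.image_mono h)

theorem eq_algebraMap_of_coeff {P : FreeAlgebra 𝕜 σ} (h : ∀ w ≠ [], coeff P w = 0) :
    P = algebraMap 𝕜 _ (coeff P []) := by
  classical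
  refine (FreeAlgebra.basisFreeMonoid 𝕜 σ).ext_elem fun w => ?_
  change coeff P w.toList = coeffₗ 𝕜 w.toList (algebraMap 𝕜 _ (coeff P []))
  rw [Algebra.algebraMap_eq_smul_one, map_smul, ← monomial_nil, coeffₗ_apply, coeff_monomial]
  by_cases hw : w.toList = []
  · simp [hw]
  · rw [h _ hw, if_neg (Ne.symm hw), smul_zero]

variable [DecidableEq σ]

theorem pderiv_monomial_cons (i a : σ) (u : List σ) :
    pderiv i (monomial 𝕜 (a :: u)) =
      (if a = i then monomial 𝕜 u else 0) + FreeAlgebra.ι 𝕜 a * pderiv i (monomial 𝕜 u) := by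
  rw [pderiv_monomial, pderiv_monomial]
  refine (Fin.sum_univ_succ _).trans ?_
  congr 1
  rw [mul_sum]
  refine sum_congr rfl fun j _ => ?_
  rw [mul_ite, mul_zero, ← monomial_cons]
  rfl

theorem pderiv_monomial_append (i : σ) (u v : List σ) :
    pderiv i (monomial 𝕜 u * monomial 𝕜 v) =
      pderiv i (monomial 𝕜 u) * monomial 𝕜 v + monomial 𝕜 u * pderiv i (monomial 𝕜 v) := by
  rw [← monomial_append]
  induction u with
  | nil =>
    have : pderiv i (monomial 𝕜 ([] : List σ)) = 0 := by rw [pderiv_monomial]; rfl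
    rw [this]; simp
  | cons a u ih =>
    rw [List.cons_append, pderiv_monomial_cons, ih, pderiv_monomial_cons, monomial_append,
      monomial_cons]
    split_ifs <;> noncomm_ring

theorem pderiv_mul (i : σ) (P Q : FreeAlgebra 𝕜 σ) :
    pderiv i (P * Q) = pderiv i P * Q + P * pderiv i Q := by
  have h := linearMap_ext_monomial (Q := Set.univ)
    (f := (pderiv i) ∘ₗ LinearMap.mulRight 𝕜 Q)
    (g := LinearMap.mulRight 𝕜 Q ∘ₗ pderiv i + LinearMap.mulRight 𝕜 (pderiv i Q))
    (fun u _ => ?_) (mem_supportedOn_univ P)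
  · simpa using h
  · have h' := linearMap_ext_monomial (Q := Set.univ)
      (f := (pderiv i) ∘ₗ LinearMap.mulLeft 𝕜 (monomial 𝕜 u))
      (g := LinearMap.mulLeft 𝕜 (pderiv i (monomial 𝕜 u)) +
        LinearMap.mulLeft 𝕜 (monomial 𝕜 u) ∘ₗ pderiv i)
      (fun v _ => by simpa using pderiv_monomial_append i u v) (mem_supportedOn_univ Q)
    simpa using h'

@[simp]
theorem pderiv_one (i : σ) : pderiv i (1 : FreeAlgebra 𝕜 σ) = 0 := by
  rw [← monomial_nil, pderiv_monomial]; rfl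

theorem pderiv_ι (i a : σ) :
    pderiv i (FreeAlgebra.ι 𝕜 a) = if a = i then 1 else 0 := by
  have := pderiv_monomial_cons (𝕜 := 𝕜) i a []
  simpa [monomial_cons] using this

end Polynomials

/-! ### Shifted variables and ordered polynomials -/

section Shift

variable {𝕜 : Type*} [RCLike 𝕜]

theorem shift_monomial (m : ℕ) (u : List ℕ) :
    shift m (monomial 𝕜 u) = monomial 𝕜 (u.map (· + m)) := by
  simp [shift, monomial, map_list_prod, Function.comp_def]

theorem shift_ι (m j : ℕ) : shift m (FreeAlgebra.ι 𝕜 j) = FreeAlgebra.ι 𝕜 (j + m) := by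
  simp [shift]

theorem shift_shift (m k : ℕ) (P : FreeAlgebra 𝕜 ℕ) : shift m (shift k P) = shift (k + m) P := by
  have : (shift m).comp (shift k) = (shift (k + m) : FreeAlgebra 𝕜 ℕ →ₐ[𝕜] _) := by
    ext j
    simp [shift_ι, add_assoc]
  exact DFunLike.congr_fun this P

theorem pderiv_shift_of_lt {i m : ℕ} (h : i < m) (P : FreeAlgebra 𝕜 ℕ) :
    pderiv i (shift m P) = 0 := by
  refine linearMap_ext_monomial (Q := Set.univ) (f := pderiv i ∘ₗ (shift m).toLinearMap) (g := 0)
    (fun u _ => ?_) (mem_supportedOn_univ P)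
  induction u with
  | nil => simp
  | cons a u ih =>
    simp only [LinearMap.comp_apply, AlgHom.toLinearMap_apply, LinearMap.zero_apply] at ih ⊢
    rw [monomial_cons, map_mul, pderiv_mul, ih trivial, shift_ι, pderiv_ι, if_neg (by omega)]
    simp

theorem pderiv_add_shift (i m : ℕ) (P : FreeAlgebra 𝕜 ℕ) :
    pderiv (i + m) (shift m P) = shift m (pderiv i P) := by
  refine linearMap_ext_monomial (Q := Set.univ) (f := pderiv (i + m) ∘ₗ (shift m).toLinearMap)
    (g := (shift m).toLinearMap ∘ₗ pderiv i) (fun u _ => ?_) (mem_supportedOn_univ P)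
  induction u with
  | nil => simp
  | cons a u ih =>
    simp only [LinearMap.comp_apply, AlgHom.toLinearMap_apply] at ih ⊢
    rw [monomial_cons, map_mul, pderiv_mul, ih trivial, shift_ι, pderiv_ι, pderiv_mul, pderiv_ι, map_add,
      map_mul, map_mul, shift_ι]
    congr 2
    split_ifs <;> first | omega | simp

/-- The words in the letters `m, …, k-1` with increasing letters. -/
def sortedWords (m k : ℕ) : Set (List ℕ) :=
  {w | w.Pairwise (· ≤ ·) ∧ ∀ j ∈ w, m ≤ j ∧ j < k}

theorem shift_mem_supportedOn {m k : ℕ} (d : ℕ) {P : FreeAlgebra 𝕜 ℕ}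
    (hP : P ∈ supportedOn 𝕜 (sortedWords m k)) :
    shift d P ∈ supportedOn 𝕜 (sortedWords (m + d) (k + d)) := by
  refine Submodule.span_induction (p := fun P _ => shift d P ∈ _) ?_ ?_ ?_ ?_ hP
  · rintro _ ⟨u, ⟨hu, hu'⟩, rfl⟩
    rw [shift_monomial]
    refine monomial_mem_supportedOn ⟨?_, ?_⟩
    · rw [List.pairwise_map]
      exact hu.imp fun h => by omega
    · simp only [List.mem_map, forall_exists_index, and_imp, forall_apply_eq_imp_iff₂]
      intro j hj
      have := hu' j hj
      omega
  · simp
  · intro P Q _ _ hP hQ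
    rw [map_add]
    exact add_mem hP hQ
  · intro c P _ hP
    rw [map_smul]
    exact Submodule.smul_mem _ _ hP

theorem sortedWords_subset {m k m' k' : ℕ} (h : m' ≤ m) (h' : k ≤ k') :
    sortedWords m k ⊆ sortedWords m' k' := fun _ hw =>
  ⟨hw.1, fun j hj => ⟨h.trans (hw.2 j hj).1, (hw.2 j hj).2.trans_le h'⟩⟩

theorem ι_mul_mem_supportedOn {m k i : ℕ} (hi : m ≤ i) (hk : i < k) {P : FreeAlgebra 𝕜 ℕ}
    (hP : P ∈ supportedOn 𝕜 (sortedWords (i + 1) k)) :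
    FreeAlgebra.ι 𝕜 i * P ∈ supportedOn 𝕜 (sortedWords m k) := by
  refine Submodule.span_induction (p := fun P _ => FreeAlgebra.ι 𝕜 i * P ∈ _) ?_ ?_ ?_ ?_ hP
  · rintro _ ⟨u, ⟨hu, hu'⟩, rfl⟩
    rw [← monomial_cons]
    refine monomial_mem_supportedOn ⟨List.pairwise_cons.2 ⟨fun j hj => ?_, hu⟩, fun j hj => ?_⟩
    · have := hu' j hj
      omega
    · rcases List.mem_cons.1 hj with rfl | hj
      · omega
      · have := hu' j hj
        omega
  · simp
  · intro P Q _ _ hP hQ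
    rw [mul_add]
    exact add_mem hP hQ
  · intro c P _ hP
    rw [mul_smul_comm]
    exact Submodule.smul_mem _ _ hP

/-- A polynomial with ordered monomials in `x_0, …, x_{k-1}` is constant if all its partial
derivatives vanish. -/
theorem coeff_eq_zero_of_pderiv {k : ℕ} {P : FreeAlgebra 𝕜 ℕ}
    (hP : P ∈ supportedOn 𝕜 (sortedWords 0 k)) (h : ∀ i < k, pderiv i P = 0) {w : List ℕ}
    (hw : w ≠ []) : coeff P w = 0 := by
  by_contra h0
  have hwk := mem_supportedOn.1 hP w h0
  obtain ⟨i, w, rfl⟩ := List.exists_cons_of_ne_nil hw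
  have hi : i < k := (hwk.2 i (by simp)).2
  -- Among ordered words only i w contributes to the coefficient of w in the i-th derivative:
  -- inserting i into w and sorting gives a unique word. Its multiplicity is a positive integer,
  -- nonzero in characteristic zero.
  have key := linearMap_ext_monomial (Q := sortedWords 0 k) (f := coeffₗ 𝕜 w ∘ₗ pderiv i)
    (g := (coeffₗ 𝕜 w (pderiv i (monomial 𝕜 (i :: w)))) • coeffₗ 𝕜 (i :: w)) (fun u hu => ?_) hP
  · have hpos : coeffₗ 𝕜 w (pderiv i (monomial 𝕜 (i :: w))) ≠ 0 := by
      rw [pderiv_monomial, map_sum]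
      have : ∀ j : Fin (i :: w).length, coeffₗ 𝕜 w
          (if (i :: w).get j = i then monomial 𝕜 ((i :: w).eraseIdx j) else 0) =
          ((if (i :: w).get j = i ∧ (i :: w).eraseIdx j = w then 1 else 0 : ℕ) : 𝕜) := by
        intro j
        split_ifs with h1 h2 h2
        · rw [coeffₗ_apply, coeff_monomial, if_pos h2.2]; simp
        · rw [coeffₗ_apply, coeff_monomial, if_neg fun h => h2 ⟨h1, h⟩]; simp
        · exact absurd h2.1 h1
        · simp
      rw [sum_congr rfl fun j _ => this j, ← Nat.cast_sum, Nat.cast_ne_zero]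
      refine (sum_pos' (fun _ _ => Nat.zero_le _) ⟨⟨0, by simp⟩, mem_univ _, ?_⟩).ne'
      simp
    rw [LinearMap.comp_apply, h i hi, map_zero, LinearMap.smul_apply, smul_eq_mul, coeffₗ_apply,
      eq_comm, mul_eq_zero] at key
    exact key.elim hpos h0
  · rw [LinearMap.comp_apply, LinearMap.smul_apply, smul_eq_mul, coeffₗ_apply (i :: w),
      coeff_monomial]
    split_ifs with he
    · rw [he, mul_one]
    · rw [mul_zero, pderiv_monomial, map_sum]
      refine sum_eq_zero fun j _ => ?_
      split_ifs with hj
      · rw [coeffₗ_apply, coeff_monomial, if_neg]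
        rintro hu'
        refine he (List.Perm.eq_of_pairwise' hu.1 hwk.1 ?_)
        rw [← hu']
        subst hj
        exact (List.getElem_cons_eraseIdx_perm j.2).symm
      · rw [map_zero]

end Shift

/-! ### Existence and uniqueness of the free Appell polynomials -/

section Appell

variable {𝕜 : Type*} [RCLike 𝕜] {A : Type*} [Ring A] [Algebra 𝕜 A]

/-- The multivariate free Appell polynomials, defined by their recursion. -/
def freeAppell (φ : A →ₗ[𝕜] 𝕜) : List A → FreeAlgebra 𝕜 ℕ
  | [] => 1
  | a :: l => FreeAlgebra.ι 𝕜 0 * shift 1 (freeAppell φ l) - ∑ j ∈ range (l.length + 1),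
      appellCumulant φ (a :: l.take j) • shift (j + 1) (freeAppell φ (l.drop j))
termination_by l => l.length
decreasing_by all_goals simp; try omega

variable {φ : A →ₗ[𝕜] 𝕜}

theorem freeAppell_nil : freeAppell φ [] = 1 := by rw [freeAppell]

theorem freeAppell_cons (a : A) (l : List A) :
    freeAppell φ (a :: l) = FreeAlgebra.ι 𝕜 0 * shift 1 (freeAppell φ l) -
      ∑ j ∈ range (l.length + 1),
        appellCumulant φ (a :: l.take j) • shift (j + 1) (freeAppell φ (l.drop j)) := by
  rw [freeAppell]

theorem subst_cons_shift (a : A) (l : List A) (j : ℕ) (P : FreeAlgebra 𝕜 ℕ) :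
    subst (a :: l) (shift (j + 1) P) = subst (l.drop j) P := by
  have : (subst (a :: l)).comp (shift (j + 1)) = (subst (l.drop j) : FreeAlgebra 𝕜 ℕ →ₐ[𝕜] A) := by
    ext i
    simp [subst, shift, ← add_assoc, add_comm]
  exact DFunLike.congr_fun this P

theorem subst_freeAppell (l : List A) : subst l (freeAppell φ l) = appellValue φ l := by
  induction h : l.length using Nat.strong_induction_on generalizing l with
  | _ k ih =>
    cases l with
    | nil => rw [freeAppell_nil, map_one, appellValue_nil]
    | cons a l =>
      simp only [List.length_cons] at h
      subst h
      rw [freeAppell_cons, appellValue_cons, map_sub, map_mul, map_sum]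
      congr 1
      · have := subst_cons_shift a l 0 (freeAppell φ l)
        rw [zero_add, List.drop_zero] at this
        rw [this, ih l.length (by simp) l rfl]
        simp [subst]
      · refine sum_congr rfl fun j _ => ?_
        rw [map_smul, subst_cons_shift, ih (l.drop j).length (by simp) _ rfl]

theorem freeAppell_mem_supportedOn (l : List A) :
    freeAppell φ l ∈ supportedOn 𝕜 (sortedWords 0 l.length) := by
  induction h : l.length using Nat.strong_induction_on generalizing l with
  | _ k ih =>
    cases l with
    | nil =>
      rw [freeAppell_nil, ← monomial_nil]
      exact monomial_mem_supportedOn ⟨List.Pairwise.nil, by simp⟩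
    | cons a l =>
      simp only [List.length_cons] at h
      subst h
      rw [freeAppell_cons]
      refine sub_mem (ι_mul_mem_supportedOn le_rfl (Nat.succ_pos _)
        (shift_mem_supportedOn 1 (ih l.length (by simp) l rfl)))
        (Submodule.sum_mem _ fun j hj => Submodule.smul_mem _ _ ?_)
      have hj' : j ≤ l.length := by simpa [Nat.lt_succ_iff] using hj
      refine supportedOn_mono (sortedWords_subset (Nat.zero_le _) ?_)
        (shift_mem_supportedOn (j + 1) (ih (l.drop j).length (by simp) _ rfl))
      rw [List.length_drop]
      omega

/-- The derivative in x_0 sees only the leading factor. A later one passes to the shorter sequences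
by induction, and the common right factor leaves the recursion of the truncated sequence. -/
theorem pderiv_freeAppell (l : List A) (i : ℕ) (hi : i < l.length) :
    pderiv i (freeAppell φ l) =
      freeAppell φ (l.take i) * shift (i + 1) (freeAppell φ (l.drop (i + 1))) := by
  induction h : l.length using Nat.strong_induction_on generalizing l i with
  | _ k ih =>
    cases l with
    | nil => simp at hi
    | cons a l =>
      simp only [List.length_cons] at h hi
      subst h
      rw [freeAppell_cons, map_sub, pderiv_mul, pderiv_ι, map_sum]
      cases i with
      | zero =>
        rw [if_pos rfl, pderiv_shift_of_lt zero_lt_one, sum_eq_zero]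
        · simp [freeAppell_nil]
        · intro j _
          rw [map_smul, pderiv_shift_of_lt (Nat.succ_pos _), smul_zero]
      | succ i =>
        have hi' : i < l.length := by omega
        rw [if_neg (by omega), zero_mul, zero_add, pderiv_add_shift, List.take_succ_cons,
          List.drop_succ_cons, freeAppell_cons, ih l.length (by simp) l i hi' rfl, map_mul,
          shift_shift, sub_mul, mul_assoc, List.length_take, min_eq_left hi'.le, sum_mul]
        congr 1
        -- For j > i the summand involves only variables of index above i + 1, so its derivative
        -- vanishes.
        rw [← sum_subset (s₁ := range (i + 1)) (range_subset_range.2 (by omega))]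
        · refine sum_congr rfl fun j hj => ?_
          obtain ⟨d, rfl⟩ := Nat.exists_eq_add_of_le (Nat.lt_succ_iff.1 (mem_range.1 hj))
          rw [map_smul, show j + d + 1 = d + (j + 1) by omega, pderiv_add_shift,
            ih (l.drop j).length (by simp) _ d (by simp; omega) rfl, map_mul, shift_shift,
            List.take_take, min_eq_left (by omega), List.drop_drop, List.drop_take, smul_mul_assoc]
          congr 3
          · rw [Nat.add_sub_cancel_left]
          · congr 1; omega
          · congr 2; omega
        · intro j _ hj
          rw [mem_range] at hj
          rw [map_smul, pderiv_shift_of_lt (by omega), smul_zero]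

theorem isFreeAppell_freeAppell (hφ : φ 1 = 1) : IsFreeAppell φ (freeAppell φ) where
  nil := freeAppell_nil
  vars l w hw j hj := ((mem_supportedOn.1 (freeAppell_mem_supportedOn l) w hw).2 j hj).2
  ordered l w hw := (mem_supportedOn.1 (freeAppell_mem_supportedOn l) w hw).1
  pderiv_eq := pderiv_freeAppell
  centered l hl := by rw [subst_freeAppell, map_appellValue hφ hl]

theorem IsFreeAppell.mem_supportedOn {𝒜 : List A → FreeAlgebra 𝕜 ℕ} (h : IsFreeAppell φ 𝒜)
    (l : List A) : 𝒜 l ∈ supportedOn 𝕜 (sortedWords 0 l.length) :=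
  FreeProb.mem_supportedOn.2 fun w hw => ⟨h.ordered l w hw, fun j hj => ⟨j.zero_le,
    h.vars l w hw j hj⟩⟩

theorem IsFreeAppell.unique (hφ : φ 1 = 1) {𝒜 ℬ : List A → FreeAlgebra 𝕜 ℕ}
    (hA : IsFreeAppell φ 𝒜) (hB : IsFreeAppell φ ℬ) : 𝒜 = ℬ := by
  funext l
  induction h : l.length using Nat.strong_induction_on generalizing l with
  | _ k ih =>
    subst h
    rcases eq_or_ne l [] with rfl | hl
    · rw [hA.nil, hB.nil]
    have h1 : 𝒜 l - ℬ l = algebraMap 𝕜 _ (coeff (𝒜 l - ℬ l) []) := by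
      refine eq_algebraMap_of_coeff fun w hw => coeff_eq_zero_of_pderiv
        (sub_mem (hA.mem_supportedOn l) (hB.mem_supportedOn l)) (fun i hi => ?_) hw
      rw [map_sub, hA.pderiv_eq l i hi, hB.pderiv_eq l i hi,
        ih (l.take i).length (by simp; omega) _ rfl, ih (l.drop (i + 1)).length
          (by simp; omega) _ rfl, sub_self]
    have h2 : φ (subst l (𝒜 l - ℬ l)) = 0 := by
      rw [map_sub, map_sub, hA.centered l hl, hB.centered l hl, sub_self]
    rw [h1, AlgHom.commutes, Algebra.algebraMap_eq_smul_one, map_smul, hφ, smul_eq_mul,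
      mul_one] at h2
    rw [h2, map_zero] at h1
    exact sub_eq_zero.1 h1

end Appell

/-! ### Products and pairings without higher cumulants -/

section Family

variable {𝕜 : Type*} [RCLike 𝕜] {A : Type*} [Ring A] [Algebra 𝕜 A] {φ : A →ₗ[𝕜] 𝕜}
  {ι : Type*} {X : ι → A}

/-- Only the splittings with cumulants of order 1 and 2 survive: a three-term recursion. -/
theorem mul_appellValue_map_cons
    (h : ∀ u : List ι, 2 < u.length → appellCumulant φ (u.map X) = 0) (a b : ι) (v : List ι) :
    X a * appellValue φ ((b :: v).map X) = appellValue φ ((a :: b :: v).map X) +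
      appellCumulant φ [X a] • appellValue φ ((b :: v).map X) +
      appellCumulant φ [X a, X b] • appellValue φ (v.map X) := by
  rw [mul_appellValue, List.map_cons (f := X) (a := b), List.length_cons, sum_range_succ', sum_range_succ',
    sum_eq_zero]
  · simp
    abel
  · intro j hj
    rw [mem_range, List.length_map] at hj
    have := h (a :: b :: v.take (j + 1)) (by simp; omega)
    simp only [List.map_cons, List.map_take] at this
    rw [List.take_succ_cons, this, zero_smul]

theorem appellValue_append_singleton_map
    (h : ∀ u : List ι, 2 < u.length → appellCumulant φ (u.map X) = 0) (a b : ι) (u : List ι) :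
    appellValue φ ((u ++ [b]).map X) * X a = appellValue φ ((u ++ [b, a]).map X) +
      appellCumulant φ [X a] • appellValue φ ((u ++ [b]).map X) +
      appellCumulant φ [X b, X a] • appellValue φ (u.map X) := by
  have h1 := appellValue_append_singleton (φ := φ) ((u ++ [b]).map X) (X a)
  have hl : ((u ++ [b]).map X).length + 1 = u.length + 2 := by simp
  have h2 : ∀ j ∈ range u.length, appellCumulant φ (((u ++ [b]).map X).drop j ++ [X a]) •
      appellValue φ (((u ++ [b]).map X).take j) = 0 := by
    intro j hj
    rw [mem_range] at hj
    have := h ((u ++ [b]).drop j ++ [a]) (by simp; omega)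
    rw [List.map_append, List.map_drop] at this
    rw [← List.map_singleton (f := X), this, zero_smul]
  rw [hl, sum_range_succ, sum_range_succ, sum_eq_zero h2] at h1
  have e : u ++ [b, a] = u ++ [b] ++ [a] := by simp
  rw [e, List.map_append (l₂ := [a]), List.map_singleton, h1]
  have e1 : ((u ++ [b]).map X).drop u.length = [X b] := by simp
  have e2 : ((u ++ [b]).map X).take u.length = u.map X := by simp
  have e3 : ((u ++ [b]).map X).drop (u.length + 1) = [] := by simp
  have e4 : ((u ++ [b]).map X).take (u.length + 1) = (u ++ [b]).map X :=
    List.take_of_length_le (by simp)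
  rw [e1, e2, e3, e4, zero_add, List.nil_append, List.singleton_append]
  abel

/-- Multiplicativity of the Appell polynomials of a family without cumulants of higher order. -/
theorem appellValue_append
    (h : ∀ u : List ι, 2 < u.length → appellCumulant φ (u.map X) = 0) (u v : List ι)
    (huv : ∀ a ∈ u.getLast?, ∀ b ∈ v.head?, appellCumulant φ [X a, X b] = 0) :
    appellValue φ (u.map X) * appellValue φ (v.map X) = appellValue φ ((u ++ v).map X) := by
  induction k : u.length using Nat.strong_induction_on generalizing u with
  | _ n ih =>
    subst k
    match u with
    | [] => simp
    | [a] =>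
      match v with
      | [] => simp
      | b :: v =>
        have e : appellValue φ ([a].map X) = X a - appellCumulant φ [X a] • 1 := by
          simp [appellValue_cons]
        rw [e, sub_mul, mul_appellValue_map_cons h, huv a (by simp) b (by simp)]
        simp
    | a :: b :: u =>
      have hb : ∀ c ∈ (b :: u).getLast?, ∀ d ∈ v.head?, appellCumulant φ [X c, X d] = 0 :=
        fun c hc => huv c (by simpa using hc)
      have hu : ∀ c ∈ u.getLast?, ∀ d ∈ v.head?, appellCumulant φ [X c, X d] = 0 := by
        intro c hc
        refine huv c ?_
        cases u with
        | nil => simp at hc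
        | cons d u => simpa using hc
      have e1 := mul_appellValue_map_cons h a b u
      have e2 := mul_appellValue_map_cons h a b (u ++ v)
      have i1 := ih (b :: u).length (by simp) (b :: u) hb rfl
      have i2 := ih u.length (by simp) u hu rfl
      rw [List.cons_append] at i1
      rw [← i1, ← i2, ← mul_assoc, e1, add_mul, add_mul, smul_mul_assoc, smul_mul_assoc] at e2
      -- The three-term recursions for u and for u v have the same coefficients; the two lower terms
      -- agree by induction and cancel.
      exact add_right_cancel (add_right_cancel e2)

/-- The recursion of the pairing of two Appell polynomials. -/
theorem map_appellValue_mul_appellValue (hφ : φ 1 = 1)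
    (h : ∀ u : List ι, 2 < u.length → appellCumulant φ (u.map X) = 0) (u v : List ι) (a b : ι) :
    φ (appellValue φ ((u ++ [a]).map X) * appellValue φ ((b :: v).map X)) =
      appellCumulant φ [X a, X b] * φ (appellValue φ (u.map X) * appellValue φ (v.map X)) := by
  induction u using List.reverseRecOn generalizing a b v with
  | nil =>
    have e := mul_appellValue_map_cons h a b v
    have e1 : appellValue φ (([] ++ [a]).map X) = X a - appellCumulant φ [X a] • 1 := by
      simp [appellValue_cons]
    rw [e1, sub_mul, e, smul_mul_assoc, one_mul, map_sub, map_add, map_add,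
      map_appellValue hφ (by simp)]
    simp
  | append_singleton u c ih =>
    have e := mul_appellValue_map_cons h a b v
    have e1 := appellValue_append_singleton_map h a c u
    have e2 := ih (b :: v) c a
    have e3 := congrArg (fun x => φ (appellValue φ ((u ++ [c]).map X) * x)) e
    have e4 := congrArg (fun x => φ (x * appellValue φ ((b :: v).map X))) e1
    simp only [mul_add, add_mul, map_add, mul_smul_comm, smul_mul_assoc, map_smul, smul_eq_mul]
      at e3 e4
    rw [mul_assoc] at e4
    rw [List.append_assoc, List.singleton_append]
    -- Both `e3` and `e4` expand φ(V(u c) X_a V(b v)), letting X_a act to the right or to the left;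
    -- by `e2` the c(c, a) term on one side cancels V(u c) paired with V(a b v) on the other.
    linear_combination e3 + e2 - e4

/-- Centering removes the constant part of V(a). This identity reads cumulants off from
orthogonality. -/
theorem map_appellValue_singleton_mul (hφ : φ 1 = 1) (a : A) (v : List A) (hv : v ≠ []) :
    φ (appellValue φ [a] * appellValue φ v) = appellCumulant φ (a :: v) := by
  have e1 : appellValue φ [a] = a - appellCumulant φ [a] • 1 := by
    simp [appellValue_cons]
  rw [e1, sub_mul, smul_mul_assoc, one_mul, map_sub, map_smul, map_appellValue hφ hv, smul_zero,
    sub_zero, appellCumulant_cons]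

theorem map_appellValue_mul_of_length_ne (hφ : φ 1 = 1)
    (h : ∀ u : List ι, 2 < u.length → appellCumulant φ (u.map X) = 0) (u v : List ι)
    (huv : u.length ≠ v.length) :
    φ (appellValue φ (u.map X) * appellValue φ (v.map X)) = 0 := by
  induction u using List.reverseRecOn generalizing v with
  | nil =>
    rw [List.map_nil, appellValue_nil, one_mul, map_appellValue hφ]
    rintro e
    simp_all
  | append_singleton u a ih =>
    cases v with
    | nil => rw [List.map_nil, appellValue_nil, mul_one, map_appellValue hφ (by simp)]
    | cons b v =>
      rw [map_appellValue_mul_appellValue hφ h, ih, mul_zero]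
      simpa using huv

/-- The pairing recursion matches the last letter of u with the first of v, hence the reversal; the
first mismatch contributes a zero covariance, and a leftover nonempty word is centered. -/
theorem map_appellValue_mul_of_ne (hφ : φ 1 = 1)
    (h : ∀ u : List ι, 2 < u.length → appellCumulant φ (u.map X) = 0)
    (h' : ∀ i j, i ≠ j → appellCumulant φ [X i, X j] = 0) (u v : List ι) (huv : u.reverse ≠ v) :
    φ (appellValue φ (u.map X) * appellValue φ (v.map X)) = 0 := by
  induction u using List.reverseRecOn generalizing v with
  | nil =>
    rw [List.map_nil, appellValue_nil, one_mul, map_appellValue hφ]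
    rintro e
    simp_all
  | append_singleton u a ih =>
    cases v with
    | nil => rw [List.map_nil, appellValue_nil, mul_one, map_appellValue hφ (by simp)]
    | cons b v =>
      rw [map_appellValue_mul_appellValue hφ h]
      rcases eq_or_ne a b with rfl | hab
      · rw [ih, mul_zero]
        simpa using huv
      · rw [h' a b hab, zero_mul]

/-- Polynomials in `x` are combinations of the Appell polynomials of the sequences `x, …, x`. -/
theorem aeval_mem_span (x : A) (P : Polynomial 𝕜) :
    Polynomial.aeval x P ∈
      Submodule.span 𝕜 (Set.range fun k => appellValue φ (List.replicate k x)) := by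
  set V := Submodule.span 𝕜 (Set.range fun k => appellValue φ (List.replicate k x)) with hV
  have hmem : ∀ k, appellValue φ (List.replicate k x) ∈ V := fun k =>
    Submodule.subset_span ⟨k, rfl⟩
  have hx : ∀ y ∈ V, x * y ∈ V := by
    intro y hy
    refine Submodule.span_induction (p := fun y _ => x * y ∈ V) ?_ ?_ ?_ ?_ hy
    · rintro _ ⟨k, rfl⟩
      simp only [mul_appellValue, ← List.replicate_succ, List.drop_replicate]
      exact add_mem (hmem _) (Submodule.sum_mem _ fun j _ => Submodule.smul_mem _ _ (hmem _))
    · simp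
    · intro y z _ _ hy hz
      rw [mul_add]
      exact add_mem hy hz
    · intro c y _ hy
      rw [mul_smul_comm]
      exact Submodule.smul_mem _ _ hy
  have hpow : ∀ k, x ^ k ∈ V := by
    intro k
    induction k with
    | zero => simpa using hmem 0
    | succ k ih => rw [pow_succ']; exact hx _ ih
  rw [Polynomial.aeval_eq_sum_range]
  exact Submodule.sum_mem _ fun j _ => Submodule.smul_mem _ _ (hpow j)

theorem aeval_mem_span_of_centered (hφ : φ 1 = 1) (x : A) (P : Polynomial 𝕜)
    (hP : φ (Polynomial.aeval x P) = 0) :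
    Polynomial.aeval x P ∈
      Submodule.span 𝕜 (Set.range fun k => appellValue φ (List.replicate (k + 1) x)) := by
  set W := Submodule.span 𝕜 (Set.range fun k => appellValue φ (List.replicate (k + 1) x)) with hW
  have hle : Submodule.span 𝕜 (Set.range fun k => appellValue φ (List.replicate k x)) ≤
      Submodule.span 𝕜 {1} ⊔ W := by
    rw [Submodule.span_le]
    rintro _ ⟨_ | k, rfl⟩
    · exact Submodule.mem_sup_left (by simp)
    · exact Submodule.mem_sup_right (Submodule.subset_span ⟨k, rfl⟩)
  obtain ⟨y, hy, z, hz, e⟩ := Submodule.mem_sup.1 (hle (aeval_mem_span (φ := φ) x P))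
  obtain ⟨c, rfl⟩ := Submodule.mem_span_singleton.1 hy
  have hz0 : φ z = 0 := by
    have : W ≤ LinearMap.ker φ := by
      rw [Submodule.span_le]
      rintro _ ⟨k, rfl⟩
      exact map_appellValue hφ (by simp)
    exact this hz
  rw [← e, map_add, map_smul, hφ, hz0, add_zero, smul_eq_mul, mul_one] at hP
  rw [← e, hP, zero_smul, zero_add]
  exact hz

/-- Neighbouring blocks involve different variables, so the junction covariance vanishes and V is
multiplicative across it. Keeping p as the first letter in the span lets the next factor be attached
on the left. -/
theorem prod_mem_span (hφ : φ 1 = 1)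
    (h : ∀ u : List ι, 2 < u.length → appellCumulant φ (u.map X) = 0)
    (h' : ∀ i j, i ≠ j → appellCumulant φ [X i, X j] = 0) (p : ι × Polynomial 𝕜)
    (l : List (ι × Polynomial 𝕜)) (hl : (p :: l).IsChain (fun p q => p.1 ≠ q.1))
    (hc : ∀ q ∈ p :: l, φ (Polynomial.aeval (X q.1) q.2) = 0) :
    ((p :: l).map fun q => Polynomial.aeval (X q.1) q.2).prod ∈
      Submodule.span 𝕜 (Set.range fun u : List ι => appellValue φ ((p.1 :: u).map X)) := by
  induction l generalizing p with
  | nil =>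
    have := aeval_mem_span_of_centered hφ _ _ (hc p (by simp))
    simp only [List.map_cons, List.map_nil, List.prod_singleton]
    refine Submodule.span_mono ?_ this
    rintro _ ⟨k, rfl⟩
    exact ⟨List.replicate k p.1, by simp [List.replicate_succ]⟩
  | cons q l ih =>
    rw [List.isChain_cons_cons] at hl
    have h1 := aeval_mem_span_of_centered hφ _ _ (hc p (by simp))
    have h2 := ih q hl.2 fun r hr => hc r (by simp [List.mem_cons.1 hr])
    rw [List.map_cons, List.prod_cons]
    refine (Submodule.span_mul_span 𝕜 _ _).le.trans (Submodule.span_mono ?_)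
      (Submodule.mul_mem_mul h1 h2)
    rintro _ ⟨_, ⟨k, rfl⟩, _, ⟨u, rfl⟩, rfl⟩
    refine ⟨List.replicate k p.1 ++ q.1 :: u, ?_⟩
    have := appellValue_append h (List.replicate (k + 1) p.1) (q.1 :: u) fun a ha b hb => by
      have ha' : a = p.1 := List.eq_of_mem_replicate (List.mem_of_getLast? ha)
      simp only [List.head?_cons, Option.mem_def, Option.some.injEq] at hb
      rw [ha', ← hb]
      exact h' _ _ hl.1
    rw [List.map_replicate] at this
    exact this.symm

end Family

/-! ### Freeness, the involution and the main theorem -/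

section Main

variable {𝕜 : Type*} [RCLike 𝕜] {A : Type*} [Ring A] [Algebra 𝕜 A] {φ : A →ₗ[𝕜] 𝕜} {n : ℕ}
  {X : Fin n → A}

theorem isFreelyIndependent_of_appellCumulant (hφ : φ 1 = 1)
    (h : ∀ u : List (Fin n), 2 < u.length → appellCumulant φ (u.map X) = 0)
    (h' : ∀ i j, i ≠ j → appellCumulant φ [X i, X j] = 0) : IsFreelyIndependent φ X := by
  intro l hl hchain hc
  obtain ⟨p, l, rfl⟩ := List.exists_cons_of_ne_nil hl
  have hle : Submodule.span 𝕜 (Set.range fun u : List (Fin n) =>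
      appellValue φ ((p.1 :: u).map X)) ≤ LinearMap.ker φ := by
    rw [Submodule.span_le]
    rintro _ ⟨u, rfl⟩
    exact map_appellValue hφ (by simp)
  exact hle (prod_mem_span hφ h h' p l hchain hc)

/-- The covariance is φ of the product of the centered linear polynomials V(X_i) and V(X_j), an
alternating product of length two. -/
theorem IsFreelyIndependent.appellCumulant_eq_zero (hφ : φ 1 = 1) (h : IsFreelyIndependent φ X)
    (i j : Fin n) (hij : i ≠ j) : appellCumulant φ [X i, X j] = 0 := by
  have e : ∀ i, Polynomial.aeval (X i) (Polynomial.X - Polynomial.C (φ (X i))) =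
      appellValue φ [X i] := by
    intro i
    simp [appellValue_cons, appellCumulant_cons, Algebra.algebraMap_eq_smul_one]
  have := h [(i, Polynomial.X - Polynomial.C (φ (X i))), (j, Polynomial.X - Polynomial.C (φ (X j)))]
    (by simp) (by simpa using hij) (by
      intro p hp
      simp only [List.mem_cons, List.not_mem_nil, or_false] at hp
      rcases hp with rfl | rfl
      all_goals exact (congrArg φ (e _)).trans (map_appellValue hφ (by simp)))
  simp only [List.map_cons, List.map_nil, List.prod_cons, List.prod_nil, mul_one, e] at this
  rwa [map_appellValue_singleton_mul hφ _ _ (by simp)] at this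

theorem lift_involution [StarRing A] [StarModule 𝕜 A] (hX : ∀ i, IsSelfAdjoint (X i))
    (P : FreeAlgebra 𝕜 (Fin n)) :
    FreeAlgebra.lift 𝕜 X (involution P) = star (FreeAlgebra.lift 𝕜 X P) := by
  have hm : ∀ u : List (Fin n), FreeAlgebra.lift 𝕜 X (monomial 𝕜 u) = (u.map X).prod := by
    intro u
    simp [monomial, map_list_prod, Function.comp_def]
  have hs : ∀ u : List (Fin n), (u.reverse.map X).prod = star (u.map X).prod := by
    intro u
    induction u with
    | nil => simp
    | cons a u ih => simpa [(hX a).star_eq] using congrArg (· * X a) ih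
  conv_rhs => rw [← sum_coeff_monomial P]
  rw [involution, map_finsuppSum, map_finsuppSum, Finsupp.sum, Finsupp.sum, star_sum]
  refine sum_congr rfl fun w _ => ?_
  rw [map_smul, map_smul, hm, hm, hs, star_smul]

theorem lift_appellFamily_freeAppell (u : List (Fin n)) :
    FreeAlgebra.lift 𝕜 X (appellFamily (freeAppell φ) X u) = appellValue φ (u.map X) := by
  rw [← subst_freeAppell, appellFamily]
  have : (FreeAlgebra.lift 𝕜 X).comp (subst (u.map (FreeAlgebra.ι 𝕜))) =
      (subst (u.map X) : FreeAlgebra 𝕜 ℕ →ₐ[𝕜] A) := by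
    ext j
    -- Beyond the length of u both substitutions take the default value 0.
    by_cases hj : j < u.length <;> simp [subst, hj]
  exact DFunLike.congr_fun this _

theorem jointDistribution_involution_mul [StarRing A] [StarModule 𝕜 A] (hφ : φ 1 = 1)
    (hφ_star : ∀ a : A, φ (star a) = star (φ a)) (hX : ∀ i, IsSelfAdjoint (X i))
    (u v : List (Fin n)) :
    jointDistribution φ X (involution (appellFamily (freeAppell φ) X u) *
      appellFamily (freeAppell φ) X v) =
      φ (appellValue φ (u.reverse.map X) * appellValue φ (v.map X)) := by
  have hs := star_appellValue hφ hφ_star (u.reverse.map X) (by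
    intro a ha
    obtain ⟨i, -, rfl⟩ := List.mem_map.1 ha
    exact hX i)
  rw [← List.map_reverse, List.reverse_reverse] at hs
  rw [jointDistribution, LinearMap.comp_apply, AlgHom.toLinearMap_apply, map_mul,
    lift_involution hX, lift_appellFamily_freeAppell, lift_appellFamily_freeAppell, hs]

end Main

end FreeProb

end

theorem mainTheorem6 {𝕜 : Type*} [RCLike 𝕜] {A : Type*} [Ring A] [StarRing A] [Algebra 𝕜 A]
    [StarModule 𝕜 A] (φ : A →ₗ[𝕜] 𝕜) (hφ_one : φ 1 = 1)
    (hφ_star : ∀ a : A, φ (star a) = star (φ a))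
    {n : ℕ} (X : Fin n → A) (hX : ∀ i, IsSelfAdjoint (X i)) :
    (∃! 𝒜 : List A → FreeAlgebra 𝕜 ℕ, FreeProb.IsFreeAppell φ 𝒜) ∧
    ∀ 𝒜 : List A → FreeAlgebra 𝕜 ℕ, FreeProb.IsFreeAppell φ 𝒜 →
      (FreeProb.IsPseudoOrthogonal (FreeProb.jointDistribution φ X)
          (FreeProb.appellFamily 𝒜 X) ↔
        FreeProb.IsSemicircularFamily φ X) ∧
      (FreeProb.IsOrthogonal (FreeProb.jointDistribution φ X)
          (FreeProb.appellFamily 𝒜 X) ↔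
        FreeProb.IsFreeSemicircularFamily φ X) := by
  have happ := FreeProb.isFreeAppell_freeAppell hφ_one
  refine ⟨⟨_, happ, fun ℬ hℬ => hℬ.unique hφ_one happ⟩, fun 𝒜 h𝒜 => ?_⟩
  obtain rfl := h𝒜.unique hφ_one happ
  have hpair := FreeProb.jointDistribution_involution_mul hφ_one hφ_star hX
  have hcum : ∀ u : List (Fin n), u ≠ [] →
      FreeProb.freeCumulant φ (u.map X) = FreeProb.appellCumulant φ (u.map X) := fun u hu =>
    FreeProb.freeCumulant_eq_appellCumulant hφ_one _ (by simpa using hu)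
  have hsemi : FreeProb.IsSemicircularFamily φ X ↔
      ∀ u : List (Fin n), 2 < u.length → FreeProb.appellCumulant φ (u.map X) = 0 := by
    have hne : ∀ u : List (Fin n), 2 < u.length → u ≠ [] := by
      rintro _ h rfl
      simp at h
    exact ⟨fun h u hu => hcum u (hne u hu) ▸ h.freeCumulant_eq_zero u hu,
      fun h => ⟨hX, fun u hu => (hcum u (hne u hu)).trans (h u hu)⟩⟩
  have hcons : ∀ (a : Fin n) (v : List (Fin n)), v ≠ [] →
      FreeProb.jointDistribution φ X
        (FreeProb.involution (FreeProb.appellFamily (FreeProb.freeAppell φ) X [a]) *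
          FreeProb.appellFamily (FreeProb.freeAppell φ) X v) =
        FreeProb.appellCumulant φ ((a :: v).map X) := fun a v hv => by
    rw [hpair]
    exact FreeProb.map_appellValue_singleton_mul hφ_one _ _ (by simpa using hv)
  have hpseudo : FreeProb.IsPseudoOrthogonal (FreeProb.jointDistribution φ X)
      (FreeProb.appellFamily (FreeProb.freeAppell φ) X) ↔ FreeProb.IsSemicircularFamily φ X := by
    rw [hsemi]
    constructor
    · intro h u hu
      obtain ⟨a, v, rfl⟩ := List.exists_cons_of_ne_nil (l := u) (by rintro rfl; simp at hu)
      simp only [List.length_cons] at hu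
      -- A word a v of length > 2 has v of length at least 2, so the lengths of the one-letter word
      -- a and of v differ.
      rw [← hcons a v (by rintro rfl; simp at hu), h]
      simp only [List.length_singleton]
      omega
    · intro h u v huv
      rw [hpair]
      exact FreeProb.map_appellValue_mul_of_length_ne hφ_one h _ _ (by simpa using huv)
  refine ⟨hpseudo, fun h => ?_, fun h => ?_⟩
  · have h1 := hpseudo.1 fun u v huv => h u v fun e => huv (e ▸ rfl)
    refine ⟨h1, FreeProb.isFreelyIndependent_of_appellCumulant hφ_one (hsemi.1 h1)
      fun i j hij => ?_⟩
    rw [← List.map_singleton (f := X), ← List.map_cons, ← hcons i [j] (by simp)]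
    exact h [i] [j] (by simpa using hij)
  · intro u v huv
    rw [hpair]
    exact FreeProb.map_appellValue_mul_of_ne hφ_one (hsemi.1 h.toIsSemicircularFamily)
      (h.isFreelyIndependent.appellCumulant_eq_zero hφ_one) _ _ (by simpa using huv)
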